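/- Call a topological group $G$ \emph{amenable} if every (jointly) continuous action of $G$ on a non-empty compact Hausdorff space $X$ admits a $G$-invariant regular Borel probability measure on $X$. Let $G$ be an amenable Polish group, and let $H$ be a closed normal subgroup of $G$ that is co-compact, that is, the quotient space $G/H$ is compact in the quotient topology. Then $H$, with the subspace topology, is amenable. -/

import Mathlib

open MeasureTheory

universe u v w

/-- A topological group `G` is *amenable* if every (jointly) continuous action of `G` on a non-empty
compact Hausdorff space `X` admits an invariant regular Borel probability measure. The universe `v`
is the one in which the spaces `X` live. -/
def IsAmenable (G : Type u) [Group G] [TopologicalSpace G] : Prop :=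
  ∀ (X : Type v) [TopologicalSpace X] [CompactSpace X] [T2Space X] [Nonempty X]
    [MeasurableSpace X] [BorelSpace X] [MulAction G X] [ContinuousSMul G X],
    ∃ μ : Measure X, IsProbabilityMeasure μ ∧ μ.Regular ∧ SMulInvariantMeasure G X μ

open Filter Topology Set

/-! Induce and disintegrate. An `H`-space `X` yields the compact `G`-space `(G × X)/H`, fibred over
`G/H` with fibre `X` over the base point. Amenability of `G` gives it an invariant probability
measure. As `H` is normal, it acts trivially on `G/H`, so conditioning on preimages of
neighbourhoods of the base point preserves `H`-invariance. A limit along shrinking neighbourhoods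
lives on the base fibre, which is `X` (`IsAmenable.exists_of_cocompact`). This is done for second
countable `X`: null sets are then local, and the induced space can be moved to the universe in which
`G` is tested. A general `X` is approximated by second countable equivariant quotients; an
ultralimit of the resulting functionals and Riesz–Markov finish (`isAmenable_of_secondCountable`).
-/

/-- A second countable T₀ space has at most continuum many points, so it has a copy in every
universe. -/
theorem small_of_secondCountableTopology (Y : Type w) [TopologicalSpace Y] [T0Space Y]
    [SecondCountableTopology Y] : Small.{v} Y := by
  have hb := TopologicalSpace.isBasis_countableBasis Y
  have : Countable (TopologicalSpace.countableBasis Y) :=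
    (TopologicalSpace.countable_countableBasis Y).to_subtype
  obtain ⟨e, he⟩ := exists_injective_nat (TopologicalSpace.countableBasis Y)
  refine small_of_injective (β := Set ℕ)
    (f := fun y ↦ e '' {s | y ∈ (s : Set Y)}) fun x y hxy ↦ ?_
  have hxy' := he.image_injective hxy
  refine hb.inseparable_iff.2 (fun s hs ↦ ?_) |>.eq
  exact Set.ext_iff.1 hxy' ⟨s, hs⟩

/-- An amenable group admits invariant probability measures on second countable compact Hausdorff
spaces of every universe. -/
theorem IsAmenable.exists_of_secondCountable {G : Type u} [Group G] [TopologicalSpace G]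
    (hG : IsAmenable.{u, v} G) (Y : Type w) [TopologicalSpace Y] [CompactSpace Y] [T2Space Y]
    [Nonempty Y] [SecondCountableTopology Y] [MeasurableSpace Y] [BorelSpace Y] [MulAction G Y]
    [ContinuousSMul G Y] :
    ∃ μ : Measure Y, IsProbabilityMeasure μ ∧ SMulInvariantMeasure G Y μ := by
  have := small_of_secondCountableTopology.{v} Y
  let e : Y ≃ₜ Shrink.{v} Y := Shrink.homeomorph Y
  have he (g : G) (y : Y) : e (g • y) = g • e y := equivShrink_smul g y
  have hes (g : G) (y : Shrink.{v} Y) : e.symm (g • y) = g • e.symm y :=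
    equivShrink_symm_smul g y
  have : CompactSpace (Shrink.{v} Y) := e.compactSpace
  have : T2Space (Shrink.{v} Y) := e.t2Space
  have : Nonempty (Shrink.{v} Y) := ⟨e (Classical.arbitrary Y)⟩
  let _ : MeasurableSpace (Shrink.{v} Y) := borel _
  have : BorelSpace (Shrink.{v} Y) := ⟨rfl⟩
  have : ContinuousSMul G (Shrink.{v} Y) := by
    refine ⟨?_⟩
    have : (fun p : G × Shrink.{v} Y ↦ p.1 • p.2) = fun p ↦ e (p.1 • e.symm p.2) := by
      ext p
      simp [he]
    rw [this]
    fun_prop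
  obtain ⟨μ, hμ, -, hinv⟩ := hG (Shrink.{v} Y)
  refine ⟨μ.map e.symm, Measure.isProbabilityMeasure_map (by fun_prop), ⟨fun g s hs ↦ ?_⟩⟩
  have hm : Measurable e.symm := e.symm.continuous.measurable
  have hg : Measurable fun y : Y ↦ g • y := (continuous_const_smul g).measurable
  rw [Measure.map_apply hm hs, Measure.map_apply hm (hg hs), ← measure_preimage_smul μ g⁻¹]
  congr 1
  ext y
  simp [hes]

/-! ### The induced space and its fibration over the coset space -/

namespace CocompactInduction

variable (G : Type u) [Group G] (H : Subgroup G) (X : Type w) [MulAction H X]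

/-- The space induced from an action of a subgroup `H` of `G` on `X`: the quotient of `G × X` by the
diagonal action of `H`. -/
abbrev Induced : Type (max u w) := MulAction.orbitRel.Quotient H (G × X)

variable {G X}

/-- The class of a pair in the induced space. -/
def mk (p : G × X) : Induced G H X := Quotient.mk'' p

variable {H}

theorem mk_eq_mk {p q : G × X} : mk H p = mk H q ↔ ∃ h : H, h • q = p := by
  rw [mk, mk, Quotient.eq'']
  rfl

theorem mk_smul (h : H) (p : G × X) : mk H (h • p) = mk H p := mk_eq_mk.2 ⟨h, rfl⟩

/-- `G` acts on the induced space by right translations on the first factor. -/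
instance : MulAction G (Induced G H X) where
  smul g := Quotient.map (fun p ↦ (p.1 * g⁻¹, p.2)) (by
    rintro p q ⟨h, rfl⟩
    exact ⟨h, by simp [Subgroup.smul_def, mul_assoc]⟩)
  one_smul := by
    rintro ⟨p⟩
    exact congrArg (mk H) (Prod.ext (by simp) rfl)
  mul_smul g g' := by
    rintro ⟨p⟩
    exact congrArg (mk H) (Prod.ext (by simp [mul_assoc]) rfl)

theorem smul_mk (g : G) (p : G × X) : g • mk H p = mk H (p.1 * g⁻¹, p.2) := rfl

/-- The projection of the induced space to the coset space. -/
def proj : Induced G H X → G ⧸ H :=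
  Quotient.lift (fun p ↦ (p.1⁻¹ : G)) (by
    rintro p q ⟨h, rfl⟩
    simp [Subgroup.smul_def])

theorem proj_mk (p : G × X) : proj (mk H p) = ((p.1⁻¹ : G) : G ⧸ H) := rfl

theorem mk_surjective : Function.Surjective (mk H : G × X → Induced G H X) := Quotient.mk''_surjective

theorem proj_smul (g : G) (y : Induced G H X) : proj (g • y) = g • proj y := by
  obtain ⟨p, rfl⟩ := mk_surjective y
  simp [smul_mk, proj_mk]

theorem proj_subgroup_smul [H.Normal] (h : H) (y : Induced G H X) : proj ((h : G) • y) = proj y := by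
  obtain ⟨p, rfl⟩ := mk_surjective y
  simp only [smul_mk, proj_mk, QuotientGroup.eq]
  simpa [mul_assoc] using ‹H.Normal›.conj_mem _ (H.inv_mem h.2) p.1

theorem mk_one_smul (h : H) (x : X) : mk H (1, h • x) = (h : G) • mk H (1, x) := by
  rw [smul_mk, mk_eq_mk]
  exact ⟨h, by simp [Subgroup.smul_def]⟩

theorem mk_one_injective : Function.Injective fun x : X ↦ mk H ((1 : G), x) := by
  intro x y hxy
  obtain ⟨h, hh⟩ := mk_eq_mk.1 hxy
  obtain ⟨h1, h2⟩ := Prod.ext_iff.1 hh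
  have : h = 1 := by simpa [Subgroup.smul_def] using h1
  simpa [this, eq_comm] using h2

theorem range_mk_one : range (fun x : X ↦ mk H ((1 : G), x)) = proj ⁻¹' {((1 : G) : G ⧸ H)} := by
  ext y
  obtain ⟨⟨g, x⟩, rfl⟩ := mk_surjective y
  constructor
  · rintro ⟨z, hz⟩
    rw [← hz]
    simp [proj_mk]
  · intro hy
    have hg : g ∈ H := by simpa [proj_mk, QuotientGroup.eq] using hy
    refine ⟨(⟨g, hg⟩ : H)⁻¹ • x, ?_⟩
    rw [mk_eq_mk]
    exact ⟨⟨g, hg⟩⁻¹, by simp [Subgroup.smul_def]⟩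

variable [TopologicalSpace G] [TopologicalSpace X] [IsTopologicalGroup G] [ContinuousSMul H X]

theorem isOpenQuotientMap_mk : IsOpenQuotientMap (mk H : G × X → Induced G H X) :=
  MulAction.isOpenQuotientMap_quotientMk

theorem continuous_mk : Continuous (mk H : G × X → Induced G H X) := isOpenQuotientMap_mk.continuous

theorem continuous_proj : Continuous (proj : Induced G H X → G ⧸ H) := by
  rw [← isOpenQuotientMap_mk.continuous_comp_iff]
  exact QuotientGroup.continuous_mk.comp (by fun_prop : Continuous fun p : G × X ↦ p.1⁻¹)

instance : ContinuousSMul G (Induced G H X) := by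
  refine ⟨?_⟩
  rw [← (IsOpenQuotientMap.id.prodMap isOpenQuotientMap_mk).continuous_comp_iff]
  exact continuous_mk.comp
    (by fun_prop : Continuous fun p : G × G × X ↦ (p.2.1 * p.1⁻¹, p.2.2))

/-- The orbit relation is closed: `h` carrying `q` to `p` must be `p.1 * q.1⁻¹`, which varies
continuously over the closed set where it lies in `H`. -/
theorem t2Space_induced [T2Space X] (hH : IsClosed (H : Set G)) : T2Space (Induced G H X) := by
  rw [t2Space_iff_of_isOpenQuotientMap (isOpenQuotientMap_mk (H := H) (X := X))]
  let C : Set ((G × X) × (G × X)) := {q | q.1.1 * q.2.1⁻¹ ∈ H}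
  have hC : IsClosed C := hH.preimage
    (by fun_prop : Continuous fun q : (G × X) × (G × X) ↦ q.1.1 * q.2.1⁻¹)
  let t : C → H := fun q ↦ ⟨_, q.2⟩
  have ht : Continuous t := Continuous.subtype_mk (by fun_prop) _
  have hD : IsClosed {q : C | t q • q.1.2.2 = q.1.1.2} :=
    isClosed_eq (ht.smul (by fun_prop)) (by fun_prop)
  convert hC.isClosedEmbedding_subtypeVal.isClosedMap _ hD
  ext ⟨p, q⟩
  simp only [mem_ofPred_eq, mk_eq_mk, mem_image]
  constructor
  · rintro ⟨h, rfl⟩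
    refine ⟨⟨(h • q, q), by simp [C, Subgroup.smul_def]⟩, ?_, rfl⟩
    have : t ⟨(h • q, q), by simp [C, Subgroup.smul_def]⟩ = h := by
      ext
      simp [t, Subgroup.smul_def]
    simp [this]
  · rintro ⟨⟨-, ha⟩, ha', rfl⟩
    refine ⟨t ⟨_, ha⟩, Prod.ext ?_ ha'⟩
    simp [t, Subgroup.smul_def]

/-- Upstairs this is the projection `G × X → G`, closed because `X` is compact. -/
theorem isClosedMap_proj [CompactSpace X] : IsClosedMap (proj : Induced G H X → G ⧸ H) := by
  intro A hA
  rw [← QuotientGroup.isOpenQuotientMap_mk.isQuotientMap.isClosed_preimage]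
  have h1 : IsClosed (Prod.fst '' (mk H ⁻¹' A)) :=
    isClosedMap_fst_of_compactSpace _ (hA.preimage continuous_mk)
  convert h1.preimage continuous_inv
  ext g
  constructor
  · rintro ⟨y, hy, hyg⟩
    obtain ⟨⟨k, x⟩, rfl⟩ := mk_surjective y
    have hk : k * g ∈ H := by simpa [proj_mk, QuotientGroup.eq] using hyg
    refine ⟨(⟨k * g, hk⟩ : H)⁻¹ • (k, x), ?_, by simp [Subgroup.smul_def]⟩
    rwa [mem_preimage, mk_smul]
  · rintro ⟨⟨k, x⟩, hy, rfl : k = g⁻¹⟩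
    exact ⟨_, hy, by simp [proj_mk]⟩

/-- Every fibre of `proj` is a translate of the base fibre, an image of `X`; hence `proj` is proper
over a compact base. -/
theorem compactSpace_induced [CompactSpace X] [CompactSpace (G ⧸ H)] :
    CompactSpace (Induced G H X) := by
  have hfib1 : IsCompact (proj ⁻¹' {((1 : G) : G ⧸ H)} : Set (Induced G H X)) := by
    rw [← range_mk_one]
    exact isCompact_range (continuous_mk.comp (by fun_prop))
  have hproper : IsProperMap (proj : Induced G H X → G ⧸ H) := by
    rw [isProperMap_iff_isClosedMap_and_compact_fibers]
    refine ⟨continuous_proj, isClosedMap_proj, fun k ↦ ?_⟩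
    obtain ⟨g, rfl⟩ := QuotientGroup.mk_surjective k
    convert hfib1.image (continuous_const_smul g)
    ext y
    rw [← image_smul.symm, mem_smul_set_iff_inv_smul_mem]
    simp only [mem_preimage, proj_smul, mem_singleton_iff, inv_smul_eq_iff]
    simp
  exact ⟨hproper.isCompact_preimage isCompact_univ⟩

theorem secondCountableTopology_induced [SecondCountableTopology G] [SecondCountableTopology X] :
    SecondCountableTopology (Induced G H X) :=
  isOpenQuotientMap_mk.isQuotientMap.secondCountableTopology isOpenQuotientMap_mk.isOpenMap

end CocompactInduction

/-! ### Conditioning near the base fibre -/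

namespace CocompactInduction

variable {G : Type u} [Group G] {H : Subgroup G} {X : Type w} [MulAction H X]
  [TopologicalSpace G] [TopologicalSpace X] [IsTopologicalGroup G] [ContinuousSMul H X]
  [MeasurableSpace (Induced G H X)]

/-- An invariant probability measure on the induced space charges the preimage of every
neighbourhood of the base point of the coset space. -/
theorem measure_proj_preimage_ne_zero [SecondCountableTopology (Induced G H X)]
    (μ : Measure (Induced G H X)) [IsProbabilityMeasure μ] [SMulInvariantMeasure G _ μ]
    {V : Set (G ⧸ H)} (hV : IsOpen V) (h1 : ((1 : G) : G ⧸ H) ∈ V) : μ (proj ⁻¹' V) ≠ 0 := by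
  intro h0
  -- Translates of the open set `proj ⁻¹' V` cover the space and would all be null.
  refine IsProbabilityMeasure.ne_zero μ (Measure.measure_univ_eq_zero.1
    (measure_null_of_locally_null _ fun y _ ↦ ?_))
  obtain ⟨k, hk⟩ := QuotientGroup.mk_surjective (proj y)
  refine ⟨(fun z ↦ k⁻¹ • z) ⁻¹' (proj ⁻¹' V), mem_nhdsWithin_of_mem_nhds ?_, ?_⟩
  · refine ((hV.preimage continuous_proj).preimage (continuous_const_smul _)).mem_nhds ?_
    rw [mem_preimage, mem_preimage, proj_smul, ← hk]
    simpa using h1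
  · rw [measure_preimage_smul, h0]

/-- Conditioning an invariant measure to the preimage of a set of cosets preserves invariance under
the normal subgroup. -/
theorem map_cond_smul [BorelSpace (Induced G H X)] [H.Normal] (μ : Measure (Induced G H X))
    [SMulInvariantMeasure G _ μ]
    {V : Set (G ⧸ H)} (hV : IsOpen V) (h : H) :
    (ProbabilityTheory.cond μ (proj ⁻¹' V)).map (fun y ↦ (h : G) • y) =
      ProbabilityTheory.cond μ (proj ⁻¹' V) := by
  have hW : MeasurableSet (proj ⁻¹' V : Set (Induced G H X)) :=
    (hV.preimage continuous_proj).measurableSet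
  have hm : Measurable fun y : Induced G H X ↦ (h : G) • y :=
    (continuous_const_smul (h : G)).measurable
  ext s hs
  rw [Measure.map_apply hm hs, ProbabilityTheory.cond_apply hW, ProbabilityTheory.cond_apply hW]
  congr 1
  rw [← measure_preimage_smul μ (h : G) (proj ⁻¹' V ∩ s)]
  congr 1
  ext y
  simp [proj_subgroup_smul]

end CocompactInduction

open CocompactInduction in
/-- The measure-theoretic core: a cocompact closed normal subgroup `H` of an amenable second
countable group `G` admits invariant probability measures on its second countable compact
Hausdorff spaces. -/
theorem IsAmenable.exists_of_cocompact {G : Type u} [Group G] [TopologicalSpace G]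
    [IsTopologicalGroup G] [SecondCountableTopology G] (hG : IsAmenable.{u, v} G) (H : Subgroup G)
    [H.Normal] (hH : IsClosed (H : Set G)) [CompactSpace (G ⧸ H)] (X : Type w) [TopologicalSpace X]
    [CompactSpace X] [T2Space X] [SecondCountableTopology X] [Nonempty X] [MeasurableSpace X]
    [BorelSpace X] [MulAction H X] [ContinuousSMul H X] :
    ∃ μ : Measure X, IsProbabilityMeasure μ ∧ SMulInvariantMeasure H X μ := by
  have := t2Space_induced (X := X) hH
  have : CompactSpace (Induced G H X) := compactSpace_induced
  have : SecondCountableTopology (Induced G H X) := secondCountableTopology_induced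
  have : Nonempty (Induced G H X) := ⟨mk H (1, Classical.arbitrary X)⟩
  have : T2Space (G ⧸ H) := inferInstance
  let _ : MeasurableSpace (Induced G H X) := borel _
  have : BorelSpace (Induced G H X) := ⟨rfl⟩
  let _ : MetricSpace (Induced G H X) := TopologicalSpace.metrizableSpaceMetric _
  obtain ⟨μ, hμ, hinv⟩ := hG.exists_of_secondCountable (Induced G H X)
  obtain ⟨V, hV, hVb⟩ := (nhds_basis_opens ((1 : G) : G ⧸ H)).exists_antitone_subbasis
  let m : ℕ → ProbabilityMeasure (Induced G H X) := fun n ↦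
    ⟨ProbabilityTheory.cond μ (proj ⁻¹' V n), ProbabilityTheory.cond_isProbabilityMeasure
      (measure_proj_preimage_ne_zero μ (hV n).2 (hV n).1)⟩
  -- Probability measures on a compact metrizable space form a compact space.
  obtain ⟨ν, hν⟩ : ∃ ν, Tendsto m (hyperfilter ℕ) (𝓝 ν) :=
    ⟨_, ((hyperfilter ℕ).map m).le_nhds_lim⟩
  have hνinv (h : H) (s : Set (Induced G H X)) (hs : MeasurableSet s) :
      (ν : Measure (Induced G H X)) ((fun y ↦ (h : G) • y) ⁻¹' s) = (ν : Measure (Induced G H X)) s := by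
    have hc : Continuous fun y : Induced G H X ↦ (h : G) • y := continuous_const_smul (h : G)
    have h1 := (ProbabilityMeasure.continuous_map hc).tendsto ν |>.comp hν
    have h2 : ν.map hc.measurable.aemeasurable = ν := by
      refine tendsto_nhds_unique h1 (hν.congr fun n ↦ ?_)
      exact Subtype.ext (map_cond_smul μ (hV n).2 h).symm
    conv_rhs => rw [← h2]
    rw [ProbabilityMeasure.toMeasure_map, Measure.map_apply hc.measurable hs]
  have hνsupp : (ν : Measure (Induced G H X)) (range fun x : X ↦ mk H ((1 : G), x))ᶜ = 0 := by
    rw [range_mk_one]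
    refine measure_null_of_locally_null _ fun y hy ↦ ?_
    obtain ⟨U, W, hU, hW, hyU, h1W, hUW⟩ := t2_separation (show proj y ≠ ((1 : G) : G ⧸ H) from hy)
    refine ⟨proj ⁻¹' U, mem_nhdsWithin_of_mem_nhds ((hU.preimage continuous_proj).mem_nhds hyU), ?_⟩
    -- Portmanteau: the mass of an open set is at most the liminf, and `V n` eventually misses `U`.
    refine le_antisymm ((ProbabilityMeasure.le_liminf_measure_open_of_tendsto hν
      (hU.preimage continuous_proj)).trans ?_) zero_le
    have hev : ∀ᶠ n in (hyperfilter ℕ : Filter ℕ),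
        (m n : Measure (Induced G H X)) (proj ⁻¹' U) = 0 := by
      refine Nat.hyperfilter_le_atTop ?_
      filter_upwards [hVb.eventually_subset (hW.mem_nhds h1W)] with n hn
      change ProbabilityTheory.cond μ (proj ⁻¹' V n) (proj ⁻¹' U) = 0
      rw [ProbabilityTheory.cond_apply ((hV n).2.preimage continuous_proj).measurableSet,
        ← preimage_inter, ((hUW.mono_right hn).symm).inter_eq]
      simp
    rw [liminf_congr hev]
    simp
  have hemb : IsClosedEmbedding fun x : X ↦ mk H ((1 : G), x) :=
    (continuous_mk.comp (by fun_prop)).isClosedEmbedding mk_one_injective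
  have hme := hemb.measurableEmbedding
  refine ⟨(ν : Measure (Induced G H X)).comap fun x : X ↦ mk H ((1 : G), x), ⟨?_⟩,
    ⟨fun h s hs ↦ ?_⟩⟩
  · rw [hme.comap_apply, image_univ]
    exact (prob_compl_eq_zero_iff hemb.isClosed_range.measurableSet).1 hνsupp
  · rw [hme.comap_apply, hme.comap_apply, ← hνinv h _ (hme.measurableSet_image.2 hs)]
    congr 1
    ext y
    constructor
    · rintro ⟨x, hx, rfl⟩
      exact ⟨_, hx, mk_one_smul h x⟩
    · rintro ⟨x, hx, hxy⟩
      refine ⟨h⁻¹ • x, by simpa using hx, ?_⟩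
      exact (mk_one_smul h⁻¹ x).trans (inv_smul_eq_iff.2 hxy)

/-! ### Second countable equivariant quotients -/

namespace EquivariantQuotient

variable {X : Type w} {Z : Type*} (Γ : Type u) [Group Γ] [MulAction Γ X] (Φ : X → Z)

/-- The map sending a point `x` to the function `g ↦ Φ (g • x)`. -/
def orbitMap (x : X) (g : Γ) : Z := Φ (g • x)

/-- The smallest equivariant quotient of `X` through which `Φ` factors. -/
abbrev OrbitQuot : Type w := Quotient (Setoid.ker (orbitMap Γ Φ))

variable {Γ Φ}

/-- The quotient map. -/
def mk (x : X) : OrbitQuot Γ Φ := Quotient.mk'' x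

theorem mk_surjective : Function.Surjective (mk : X → OrbitQuot Γ Φ) := Quotient.mk''_surjective

theorem mk_eq_mk {x y : X} : (mk x : OrbitQuot Γ Φ) = mk y ↔ ∀ g : Γ, Φ (g • x) = Φ (g • y) :=
  Quotient.eq''.trans funext_iff

instance : MulAction Γ (OrbitQuot Γ Φ) where
  smul g := Quotient.map (g • ·) (fun x y hxy ↦ funext fun k ↦ by
    simpa [orbitMap, mul_smul] using congrFun hxy (k * g))
  one_smul := by
    rintro ⟨x⟩
    exact congrArg mk (one_smul Γ x)
  mul_smul g h := by
    rintro ⟨x⟩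
    exact congrArg mk (mul_smul g h x)

theorem smul_mk (g : Γ) (x : X) : g • (mk x : OrbitQuot Γ Φ) = mk (g • x) := rfl

/-- The map induced by `Φ` on the quotient. -/
def lift (y : OrbitQuot Γ Φ) : Z := Setoid.kerLift (orbitMap Γ Φ) y 1

theorem lift_mk (x : X) : lift (mk x : OrbitQuot Γ Φ) = Φ x := congrArg Φ (one_smul Γ x)

theorem continuous_mk [TopologicalSpace X] : Continuous (mk : X → OrbitQuot Γ Φ) :=
  continuous_quotient_mk'

variable [TopologicalSpace X] [TopologicalSpace Z] [TopologicalSpace Γ] [ContinuousSMul Γ X]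

theorem continuous_kerLift (hΦ : Continuous Φ) : Continuous (Setoid.kerLift (orbitMap Γ Φ)) :=
  Continuous.quotient_lift (continuous_pi fun g ↦ hΦ.comp (continuous_const_smul g)) _

theorem continuous_lift (hΦ : Continuous Φ) : Continuous (lift : OrbitQuot Γ Φ → Z) :=
  (continuous_apply 1).comp (continuous_kerLift hΦ)

theorem t2Space [T2Space Z] (hΦ : Continuous Φ) : T2Space (OrbitQuot Γ Φ) :=
  T2Space.of_injective_continuous (Setoid.kerLift_injective _) (continuous_kerLift hΦ)

/-- By continuity in `g`, a dense sequence in `Γ` already separates points, so the compact quotient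
embeds in `ℕ → Z`. -/
theorem secondCountableTopology [CompactSpace X] [T2Space Z] [SecondCountableTopology Z]
    [TopologicalSpace.SeparableSpace Γ] (hΦ : Continuous Φ) :
    SecondCountableTopology (OrbitQuot Γ Φ) := by
  let j : OrbitQuot Γ Φ → ℕ → Z := fun y n ↦
    Setoid.kerLift (orbitMap Γ Φ) y (TopologicalSpace.denseSeq Γ n)
  have hj : Continuous j :=
    continuous_pi fun n ↦ (continuous_apply _).comp (continuous_kerLift hΦ)
  have hinj : Function.Injective j := by
    intro y y' hyy'
    obtain ⟨x, rfl⟩ := mk_surjective y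
    obtain ⟨x', rfl⟩ := mk_surjective y'
    refine mk_eq_mk.2 fun g ↦ congrFun (Continuous.ext_on
      (f := fun g : Γ ↦ Φ (g • x)) (g := fun g : Γ ↦ Φ (g • x'))
      (TopologicalSpace.denseRange_denseSeq Γ) (by fun_prop) (by fun_prop) ?_) g
    rintro _ ⟨n, rfl⟩
    exact congrFun hyy' n
  exact (hj.isClosedEmbedding hinj).isEmbedding.secondCountableTopology

/-- `Γ` need not be locally compact, so `id × mk` is shown to be a quotient map through properness
of `mk`. -/
theorem continuousSMul [CompactSpace X] [T2Space Z] (hΦ : Continuous Φ) :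
    ContinuousSMul Γ (OrbitQuot Γ Φ) := by
  have := t2Space (Γ := Γ) hΦ
  have hq : IsQuotientMap (Prod.map id mk : Γ × X → Γ × OrbitQuot Γ Φ) :=
    (isProperMap_id.prodMap continuous_mk.isProperMap).isClosedMap.isQuotientMap
      (continuous_id.prodMap continuous_mk) (Function.surjective_id.prodMap mk_surjective)
  exact ⟨hq.continuous_iff.2 (continuous_mk.comp continuous_smul)⟩

end EquivariantQuotient

/-! ### Passage to arbitrary compact spaces -/

section Limit

variable {X : Type w} [TopologicalSpace X] [CompactSpace X]
  {Γ : Type u} [Group Γ] [TopologicalSpace Γ] [MulAction Γ X] [ContinuousSMul Γ X]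

open EquivariantQuotient in
/-- If second countable compact Hausdorff spaces carry invariant probability measures, then on every
compact space there are normalized positive functionals which are additive and invariant on a given
finite set of continuous functions. -/
theorem exists_functional_of_finset [TopologicalSpace.SeparableSpace Γ] [Nonempty X]
    (h : ∀ (Y : Type w) [TopologicalSpace Y] [CompactSpace Y] [T2Space Y] [Nonempty Y]
      [SecondCountableTopology Y] [MeasurableSpace Y] [BorelSpace Y] [MulAction Γ Y]
      [ContinuousSMul Γ Y], ∃ μ : Measure Y, IsProbabilityMeasure μ ∧ SMulInvariantMeasure Γ Y μ)
    (F : Finset C(X, ℝ)) :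
    ∃ L : C(X, ℝ) → ℝ, (∀ f, |L f| ≤ ‖f‖) ∧ (∀ f, 0 ≤ f → 0 ≤ L f) ∧ L 1 = 1 ∧
      (∀ (c : ℝ) f, L (c • f) = c * L f) ∧ (∀ f ∈ F, ∀ f' ∈ F, L (f + f') = L f + L f') ∧
      ∀ f ∈ F, ∀ f' ∈ F, ∀ g : Γ, (∀ x, f' x = f (g • x)) → L f' = L f := by
  let Φ : X → F → ℝ := fun x f ↦ f.1 x
  have hΦ : Continuous Φ := by fun_prop
  have := t2Space (Γ := Γ) hΦ
  have := secondCountableTopology (Γ := Γ) hΦ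
  have := continuousSMul (Γ := Γ) hΦ
  have : Nonempty (OrbitQuot Γ Φ) := ⟨mk (Classical.arbitrary X)⟩
  let _ : MeasurableSpace (OrbitQuot Γ Φ) := borel _
  have : BorelSpace (OrbitQuot Γ Φ) := ⟨rfl⟩
  obtain ⟨μ, hμ, hinv⟩ := h (OrbitQuot Γ Φ)
  let s : OrbitQuot Γ Φ → X := Function.surjInv mk_surjective
  have hs (y : OrbitQuot Γ Φ) : mk (s y) = y := Function.surjInv_eq mk_surjective y
  have hfac (f : C(X, ℝ)) (hf : f ∈ F) (y : OrbitQuot Γ Φ) : f (s y) = lift y ⟨f, hf⟩ := by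
    conv_rhs => rw [← hs y, lift_mk]
  have hcont (f : C(X, ℝ)) (hf : f ∈ F) : Continuous fun y ↦ f (s y) := by
    simp_rw [hfac f hf]
    exact (continuous_apply _).comp (continuous_lift hΦ)
  have hint (f : C(X, ℝ)) (hf : f ∈ F) : Integrable (fun y ↦ f (s y)) μ :=
    (hcont f hf).integrable_of_hasCompactSupport (HasCompactSupport.of_compactSpace _)
  -- The section `s` need not be measurable. Outside `F` the integral may take the default value 0,
  -- which respects the bound, positivity and homogeneity; additivity needs `F`.
  refine ⟨fun f ↦ ∫ y, f (s y) ∂μ, fun f ↦ ?_, fun f hf ↦ integral_nonneg fun y ↦ hf (s y), by simp,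
    fun c f ↦ by simp [integral_const_mul], fun f hf f' hf' ↦ integral_add (hint f hf) (hint f' hf'),
    fun f hf f' hf' g hg ↦ ?_⟩
  · simpa using norm_integral_le_of_norm_le_const (μ := μ)
      (Eventually.of_forall fun y ↦ f.norm_coe_le_norm (s y))
  · have hmk (x : X) : f (s (mk x)) = f x := by rw [hfac f hf, lift_mk]
    have hsm (y : OrbitQuot Γ Φ) : f' (s y) = f (s (g • y)) := by
      rw [hg, ← hmk, ← smul_mk, hs]
    simp_rw [hsm]
    have hmp : MeasurePreserving (fun y : OrbitQuot Γ Φ ↦ g • y) μ μ := measurePreserving_smul g μ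
    exact hmp.integral_comp (Homeomorph.smul g).measurableEmbedding fun y ↦ f (s y)

/-- If second countable compact Hausdorff spaces carry invariant probability measures, then every
compact space has an invariant normalized positive linear functional on continuous functions. -/
theorem exists_invariant_functional [TopologicalSpace.SeparableSpace Γ] [Nonempty X]
    (h : ∀ (Y : Type w) [TopologicalSpace Y] [CompactSpace Y] [T2Space Y] [Nonempty Y]
      [SecondCountableTopology Y] [MeasurableSpace Y] [BorelSpace Y] [MulAction Γ Y]
      [ContinuousSMul Γ Y], ∃ μ : Measure Y, IsProbabilityMeasure μ ∧ SMulInvariantMeasure Γ Y μ) :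
    ∃ L : C(X, ℝ) →ₗ[ℝ] ℝ, (∀ f, 0 ≤ f → 0 ≤ L f) ∧ L 1 = 1 ∧
      ∀ f f' : C(X, ℝ), ∀ g : Γ, (∀ x, f' x = f (g • x)) → L f' = L f := by
  classical
  choose L hbd hpos hone hsmul hadd hinv using exists_functional_of_finset (X := X) h
  -- Each function eventually lies in `F`, so identities valid on `F` pass to the limit.
  let 𝒰 : Ultrafilter (Finset C(X, ℝ)) := Ultrafilter.of atTop
  have hmem (f : C(X, ℝ)) : ∀ᶠ F in (𝒰 : Filter (Finset C(X, ℝ))), f ∈ F :=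
    Ultrafilter.of_le _ ((eventually_ge_atTop {f}).mono fun F hF ↦ Finset.singleton_subset_iff.1 hF)
  have hlim (f : C(X, ℝ)) : ∃ l, Tendsto (fun F ↦ L F f) 𝒰 (𝓝 l) := by
    obtain ⟨l, -, hl⟩ := (isCompact_Icc (a := -‖f‖) (b := ‖f‖)).ultrafilter_le_nhds
      (𝒰.map fun F ↦ L F f) (le_principal_iff.2 (Ultrafilter.mem_map.2 (univ_mem' fun F ↦ abs_le.1 (hbd F f))))
    exact ⟨l, hl⟩
  choose l hl using hlim
  refine ⟨{ toFun := l, map_add' := fun f f' ↦ ?_, map_smul' := fun c f ↦ ?_ }, fun f hf ↦ ?_, ?_,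
    fun f f' g hg ↦ ?_⟩
  · refine tendsto_nhds_unique (hl (f + f')) (((hl f).add (hl f')).congr' ?_)
    filter_upwards [hmem f, hmem f'] with F hf hf' using (hadd F f hf f' hf').symm
  · refine tendsto_nhds_unique (hl (c • f)) (((hl f).const_mul c).congr fun F ↦ ?_)
    exact (hsmul F c f).symm
  · exact ge_of_tendsto' (hl f) fun F ↦ hpos F f hf
  · exact tendsto_nhds_unique (hl 1) (tendsto_const_nhds.congr fun F ↦ (hone F).symm)
  · refine tendsto_nhds_unique (hl f') ((hl f).congr' ?_)
    filter_upwards [hmem f, hmem f'] with F hf hf' using (hinv F f hf f' hf' g hg).symm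

end Limit

open scoped CompactlySupported in
/-- A separable group is amenable as soon as its second countable compact Hausdorff spaces carry
invariant probability measures. -/
theorem isAmenable_of_secondCountable {Γ : Type u} [Group Γ] [TopologicalSpace Γ]
    [TopologicalSpace.SeparableSpace Γ]
    (h : ∀ (Y : Type w) [TopologicalSpace Y] [CompactSpace Y] [T2Space Y] [Nonempty Y]
      [SecondCountableTopology Y] [MeasurableSpace Y] [BorelSpace Y] [MulAction Γ Y]
      [ContinuousSMul Γ Y], ∃ μ : Measure Y, IsProbabilityMeasure μ ∧ SMulInvariantMeasure Γ Y μ) :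
    IsAmenable.{u, w} Γ := by
  intro X _ _ _ _ _ _ _ _
  obtain ⟨L, hpos, hone, hinv⟩ := exists_invariant_functional (X := X) h
  let Λ : C_c(X, ℝ) →ₚ[ℝ] ℝ :=
  { toFun f := L f.toContinuousMap
    map_add' f f' := L.map_add _ _
    map_smul' c f := L.map_smul _ _
    monotone' f f' hff' := by
      have := hpos (f'.toContinuousMap - f.toContinuousMap) (sub_nonneg.2 hff')
      rw [map_sub] at this
      exact sub_nonneg.1 this }
  have hΛ (f : C(X, ℝ)) : ∫ x, f x ∂(RealRMK.rieszMeasure Λ) = L f :=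
    RealRMK.integral_rieszMeasure Λ ⟨f, HasCompactSupport.of_compactSpace _⟩
  refine ⟨RealRMK.rieszMeasure Λ, ⟨?_⟩, inferInstance, ⟨fun g s hs ↦ ?_⟩⟩
  · have h1 := hΛ 1
    rw [hone] at h1
    simpa [measureReal_def, ENNReal.toReal_eq_one_iff] using h1
  · have hreg : ((RealRMK.rieszMeasure Λ).map (g • ·)).Regular :=
      Measure.Regular.map (Homeomorph.smul g)
    have hc : Continuous fun x : X ↦ g • x := continuous_const_smul g
    -- Both measures are regular, so integrals of continuous functions determine them.
    have hmap : (RealRMK.rieszMeasure Λ).map (g • ·) = RealRMK.rieszMeasure Λ := by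
      refine Measure.ext_of_integral_eq_on_compactlySupported fun f ↦ ?_
      refine (integral_map hc.measurable.aemeasurable f.continuous.aestronglyMeasurable).trans ?_
      exact ((hΛ (f.toContinuousMap.comp ⟨_, hc⟩)).trans
        (hinv f.toContinuousMap _ g fun x ↦ rfl)).trans (hΛ f.toContinuousMap).symm
    rw [← Measure.map_apply hc.measurable hs, hmap]

theorem theorem4 (G : Type u) [Group G] [TopologicalSpace G] [IsTopologicalGroup G] [PolishSpace G]
    (hG : IsAmenable.{u, v} G)
    (H : Subgroup G) (hH_normal : H.Normal) (hH_closed : IsClosed (H : Set G))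
    (hH_cocompact : CompactSpace (G ⧸ H)) :
    IsAmenable.{u, w} H := by
  have : SecondCountableTopology H := TopologicalSpace.Subtype.secondCountableTopology (H : Set G)
  refine isAmenable_of_secondCountable fun Y _ _ _ _ _ _ _ _ _ ↦ ?_
  exact hG.exists_of_cocompact H hH_closed Y
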